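/- Let $k$ be a field and $G$ a (discrete) group. An $E_\infty$-algebra is an algebra over the (unital) Barratt–Eccles operad in unbounded differential graded vector spaces over $k$; the category of these is denoted $E_\infty\text{-}\mathsf{Alg}$. It is tensored over simplicial sets: morphisms $K\otimes A\to B$ are the morphisms $A\to B^K=\mathrm{Hom}(N_*(K;k),B)$, where the operad acts on $B^K$ through its Alexander–Whitney diagonal and its standard (Berger–Fresse) action on normalized chains. A $G$-equivariant $E_\infty$-algebra is a functor $A:\star/\!/G\to E_\infty\text{-}\mathsf{Alg}$, and $QA\to A$ denotes a cofibrant replacement of $A$ as an $E_\infty$-algebra, on which $G$ acts compatibly (weak equivalences are the quasi-isomorphisms, fibrations the degreewise surjections). A space is a simplicial set. A $G$-bundle over a simplicial set $Y$ is a simplicial set $P$ with right $G$-action and an invariant map $P\to Y$ whose fibres in each simplicial degree are nonempty, free and transitive $G$-sets. For such $P$ put $$\int_P A:=P\overset{\mathbb L}{\otimes}_G A=\int^{[n]\in\Delta}\bigl(P\times\Delta_n\times G^n\bigr)\otimes QA\ \in E_\infty\text{-}\mathsf{Alg},$$ the realization of the two-sided bar construction $B_*(P,\star/\!/G,QA)$.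 Let $\Phi:X\to Y$ be an isomorphism of simplicial sets, $P$ a $G$-bundle over $Y$, and $A$ a $G$-equivariant $E_\infty$-algebra. Then, for every choice of $QA$, the morphism $\int_{\Phi^*P}A\to\int_P A$ induced by the canonical $G$-equivariant projection $\Phi^*P=X\times_Y P\to P$ is an isomorphism of $E_\infty$-algebras. Consequently, equivariant higher Hochschild chains are essentially constant on mapping class group orbits: if $P$ and $P'$ are $G$-bundles over a simplicial set $X$ whose isomorphism classes lie in the same orbit of the mapping class group of $X$, i.e. $P'\cong\Phi^*P$ as $G$-bundles for some automorphism $\Phi$ of $X$, then $\int_P A\cong\int_{P'}A$ for every $G$-equivariant $E_\infty$-algebra $A$. -/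

import Mathlib

open CategoryTheory Opposite

universe u

/-! ## The Barratt–Eccles operad: permutations, shuffles, and the action on simplicial chains

A permutation `w : Equiv.Perm (Fin r)` is read as the sequence `w 0, w 1, …, w (r - 1)` of its
values.  In arity `r` and degree `d` the Barratt–Eccles operad `E` is spanned by the sequences
`(w 0, …, w d)` of permutations of `Fin r`, modulo those with two equal consecutive entries; that
is, `E r` is the complex of normalized chains of the simplicial set `[d] ↦ (Perm (Fin r))^(d+1)`. -/

namespace BarrattEccles

/-- The composition `u(v 0, …, v (r-1))` in the operad of permutations: in the sequence `u`, the
value `i` is replaced by the sequence `v i`, its values being shifted into the `i`-th block. -/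
def permComp {r : ℕ} (s : Fin r → ℕ) (u : Equiv.Perm (Fin r))
    (v : ∀ i, Equiv.Perm (Fin (s i))) : Equiv.Perm (Fin (∑ i, s i)) :=
  (finCongr (Equiv.sum_comp u s).symm).trans
    (finSigmaFinEquiv.symm.trans
      ((Equiv.sigmaCongr u (fun p => v (u p))).trans finSigmaFinEquiv))

/-- The shuffles: the nondegenerate simplices of maximal dimension `N = D 0 + ⋯ + D (a-1)` of the
product of the standard simplices of dimensions `D 0, …, D (a-1)`. -/
abbrev Shuffle {a : ℕ} (D : Fin a → ℕ) (N : ℕ) : Type :=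
  {x : Fin (N + 1) → ∀ c, Fin (D c + 1) // StrictMono x}

noncomputable instance {a : ℕ} (D : Fin a → ℕ) (N : ℕ) : Fintype (Shuffle D N) :=
  Fintype.ofFinite _

/-- The exponent of the sign of a shuffle: the number of pairs of steps of the path `x` in which
a step in direction `c'` precedes a step in direction `c`, for `c < c'`. -/
def shuffleExponent {a : ℕ} {D : Fin a → ℕ} {N : ℕ} (x : Shuffle D N) : ℕ :=
  ∑ t : Fin N, ∑ c : Fin a, ∑ c' : Fin a,
    if c < c' then
      ((x.1 t.succ c : ℕ) - (x.1 t.castSucc c : ℕ)) * (x.1 t.castSucc c' : ℕ) else 0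

/-- The dimensions of the factors of a composition in the Barratt–Eccles operad. -/
def compDims {r : ℕ} (d : ℕ) (e : Fin r → ℕ) : Fin (r + 1) → ℕ := Fin.cons d e

/-- The simplex of `E (∑ i, s i)` that the shuffle `x` contributes to the composition
`u(v 0, …, v (r-1))`. -/
def compSimplex {r d : ℕ} {s e : Fin r → ℕ} (u : Fin (d + 1) → Equiv.Perm (Fin r))
    (v : ∀ i, Fin (e i + 1) → Equiv.Perm (Fin (s i)))
    (x : Shuffle (compDims d e) (d + ∑ i, e i)) :
    Fin (d + ∑ i, e i + 1) → Equiv.Perm (Fin (∑ i, s i)) :=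
  fun t => permComp s (u (x.1 t 0)) (fun i => v i (x.1 t i.succ))

/-- The table reduction map from the Barratt–Eccles operad to the surjection operad.
A simplex of `E r` is given by the list of its permutations, each of them as a list of values.
The output lists the surjections (as sequences of values) whose sum is the image; an entry
of the sequence comes with the Boolean `true` if it is not the last occurrence of its
value in that sequence, and with `false` if it is. Each row but the last one consists of `t + 1`
entries of the current permutation, and the first `t` of them are deleted from all later ones. -/
def tableReduction {α : Type} [DecidableEq α] : List (List α) → List (List (α × Bool))
  | [] => []
  | [w] => [w.map fun a => (a, false)]
  | w :: w' :: ws =>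
    (List.range w.length).flatMap fun t =>
      (tableReduction ((w' :: ws).map fun l => l.filter fun a => a ∉ w.take t)).map fun s =>
        (w.take t).map (fun a => (a, false)) ++ ((w.drop t).take 1).map (fun a => (a, true)) ++ s
termination_by l => l.length

/-- The ways of cutting the interval `{p, …, n}` into consecutive intervals `{lo, …, hi}` (two
neighbours share one endpoint) labelled by the entries of the given sequence. -/
def intervalCuts {β : Type} (n : ℕ) : ℕ → List β → List (List (β × ℕ × ℕ))
  | p, [] => if p = n then [[]] else []
  | p, b :: s => (List.range' p (n + 1 - p)).flatMap fun q =>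
      (intervalCuts n q s).map fun c => (b, p, q) :: c

/-- The vertices of the intervals labelled by `i`. -/
def cutVertices {α : Type} [DecidableEq α] (i : α) (c : List ((α × Bool) × ℕ × ℕ)) : List ℕ :=
  (c.filter fun z => z.1.1 = i).flatMap fun z => List.range' z.2.1 (z.2.2 + 1 - z.2.1)

/-- The degree of a labelled interval: its length, plus one if its label occurs again later. -/
def cutDegree {α : Type} (z : (α × Bool) × ℕ × ℕ) : ℕ :=
  z.2.2 - z.2.1 + if z.1.2 then 1 else 0

/-- The exponent of the sign of an interval cut: the Koszul sign of the permutation that sorts the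
intervals by their labels, and the sum of the end positions of the intervals whose label occurs
again later. -/
def cutExponent {r : ℕ} : List ((Fin r × Bool) × ℕ × ℕ) → ℕ
  | [] => 0
  | z :: c => ((c.filter fun z' => z'.1.1 < z.1.1).map fun z' => cutDegree z * cutDegree z').sum
      + (if z.1.2 then z.2.2 else 0) + cutExponent c

/-- The coefficients of the action `E r ⊗ N_*(K) → N_*(K)^{⊗ r}` of the Barratt–Eccles operad on
normalized simplicial chains (Berger–Fresse): for a simplex `ws` of `E r` and an `n`-simplex `x` of
a simplicial set `K`, the chain `ws(x)` is the sum over all families `θ` of monotone maps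
`θ i : [q i] → [n]` of this integer times `θ_0^* x ⊗ ⋯ ⊗ θ_{r-1}^* x`. -/
def coactionCoeff {r : ℕ} (ws : List (List (Fin r))) (n : ℕ) (θ : Fin r → List ℕ) : ℤ :=
  ((((tableReduction ws).flatMap (intervalCuts n 0)).filter
    fun c => ∀ i, cutVertices i c = θ i).map fun c => (-1) ^ cutExponent c).sum

/-- A sequence of permutations as a list of lists of values. -/
def toLists {r d : ℕ} (w : Fin (d + 1) → Equiv.Perm (Fin r)) : List (List (Fin r)) :=
  List.ofFn fun t => List.ofFn (w t)

/-- The front face `(w 0, …, w j)`. -/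
def front {r d : ℕ} (w : Fin (d + 1) → Equiv.Perm (Fin r)) (j : Fin (d + 1)) :
    Fin ((j : ℕ) + 1) → Equiv.Perm (Fin r) :=
  fun t => w ⟨t, by omega⟩

/-- The values of a monotone map between finite ordinals. -/
def mapValues {q n : ℕ} (θ : SimplexCategory.mk q ⟶ SimplexCategory.mk n) : List ℕ :=
  List.ofFn fun t => (θ.toOrderHom t : ℕ)

end BarrattEccles

open BarrattEccles

/-! ## Algebras over the Barratt–Eccles operad -/

/-- For `c = true` the differential of a complex in degree `n`, for `c = false` the identity. -/
def dSlot {k : Type u} [Field k] (X : ChainComplex (ModuleCat.{u} k) ℤ) (n : ℤ) :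
    (c : Bool) → X.X n →ₗ[k] X.X (bif c then n - 1 else n)
  | true => (X.d n (n - 1)).hom
  | false => LinearMap.id

/-- An `E_∞`-algebra in (unbounded) differential graded vector spaces over `k`: an algebra over the
Barratt–Eccles operad. The multilinear map `op w n m` is the operation given by the simplex
`w = (w 0, …, w d)` of `E r`, on arguments of degrees `n 0, …, n (r-1)`, with values in degree `m`;
as for the differentials of a complex, it is set to zero unless `m = d + ∑ i, n i`. -/
structure EInftyAlg (k : Type u) [Field k] where
  X : ChainComplex (ModuleCat.{u} k) ℤ
  op : ∀ {r d : ℕ} (_ : Fin (d + 1) → Equiv.Perm (Fin r)) (n : Fin r → ℤ) (m : ℤ),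
    MultilinearMap k (fun i => X.X (n i)) (X.X m)
  op_shape : ∀ {r d : ℕ} (w : Fin (d + 1) → Equiv.Perm (Fin r)) (n : Fin r → ℤ) (m : ℤ),
    m ≠ d + ∑ i, n i → op w n m = 0
  /-- Degenerate simplices of `E r` act by zero. -/
  op_degenerate : ∀ {r d : ℕ} (w : Fin (d + 1) → Equiv.Perm (Fin r)) (n : Fin r → ℤ) (m : ℤ),
    (∃ t : Fin d, w t.castSucc = w t.succ) → op w n m = 0
  /-- The differential of an operation by a `0`-simplex. -/
  d_op_zero : ∀ {r : ℕ} (w : Fin (0 + 1) → Equiv.Perm (Fin r)) (n : Fin r → ℤ) (m : ℤ),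
    m = ∑ i, n i → ∀ a : ∀ i, X.X (n i),
    (X.d m (m - 1)).hom (op w n m a) =
      ∑ j : Fin r, ((∑ i : Fin r, if i < j then n i else 0).negOnePow : ℤ) •
        op w (fun i => bif decide (i = j) then n i - 1 else n i) (m - 1)
          (fun i => dSlot X (n i) (decide (i = j)) (a i))
  /-- The differential of an operation by a `(d + 1)`-simplex. -/
  d_op_succ : ∀ {r d : ℕ} (w : Fin (d + 1 + 1) → Equiv.Perm (Fin r)) (n : Fin r → ℤ) (m : ℤ),
    m = (d + 1 : ℕ) + ∑ i, n i → ∀ a : ∀ i, X.X (n i),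
    (X.d m (m - 1)).hom (op w n m a) =
      ∑ t : Fin (d + 1 + 1), ((-1 : ℤ) ^ (t : ℕ)) • op (w ∘ t.succAbove) n (m - 1) a +
      ∑ j : Fin r, (((d + 1 : ℕ) + ∑ i : Fin r, if i < j then n i else 0).negOnePow : ℤ) •
        op w (fun i => bif decide (i = j) then n i - 1 else n i) (m - 1)
          (fun i => dSlot X (n i) (decide (i = j)) (a i))
  /-- The unit of the operad acts by the identity. -/
  op_unit : ∀ (n : ℤ) (a : X.X n),
    op (r := 1) (d := 0) (fun _ => 1) (fun _ => n) n (fun _ => a) = a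
  /-- Equivariance, with the Koszul sign. -/
  op_perm : ∀ {r d : ℕ} (σ : Equiv.Perm (Fin r)) (w : Fin (d + 1) → Equiv.Perm (Fin r))
    (n : Fin r → ℤ) (m : ℤ) (a : ∀ i, X.X (n i)),
    op (fun t => σ * w t) n m a =
      ((∑ i : Fin r, ∑ j : Fin r,
          if i < j ∧ σ j < σ i then n (σ i) * n (σ j) else 0).negOnePow : ℤ) •
        op w (fun i => n (σ i)) m (fun i => a (σ i))
  /-- Compatibility with the composition of the operad, which is the shuffle map followed by the
  composition of permutations. -/
  op_comp : ∀ {r d : ℕ} {s e : Fin r → ℕ} (w : Fin (d + 1) → Equiv.Perm (Fin r))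
    (v : ∀ i, Fin (e i + 1) → Equiv.Perm (Fin (s i))) (n : ∀ i, Fin (s i) → ℤ) (m : ℤ)
    (a : ∀ i q, X.X (n i q)),
    op w (fun i => e i + ∑ q, n i q) m (fun i => op (v i) (n i) (e i + ∑ q, n i q) (a i)) =
      ((∑ i : Fin r, ∑ j : Fin r,
          if j < i then (e i : ℤ) * ∑ q, n j q else 0).negOnePow : ℤ) •
        ∑ x : Shuffle (compDims d e) (d + ∑ i, e i), ((-1 : ℤ) ^ shuffleExponent x) •
          op (compSimplex w v x)
            (fun p => n (finSigmaFinEquiv.symm p).1 (finSigmaFinEquiv.symm p).2) m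
            (fun p => a (finSigmaFinEquiv.symm p).1 (finSigmaFinEquiv.symm p).2)

namespace EInftyAlg

variable {k : Type u} [Field k]

/-- Morphisms of `E_∞`-algebras: chain maps that commute with all operations. -/
@[ext]
structure Hom (A B : EInftyAlg k) where
  hom : A.X ⟶ B.X
  map_op : ∀ {r d : ℕ} (w : Fin (d + 1) → Equiv.Perm (Fin r)) (n : Fin r → ℤ) (m : ℤ)
    (a : ∀ i, A.X.X (n i)),
    (hom.f m).hom (A.op w n m a) = B.op w n m (fun i => (hom.f (n i)).hom (a i))

instance : Category (EInftyAlg k) where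
  Hom := Hom
  id A := ⟨𝟙 A.X, fun w n m a => by simp⟩
  comp f g := ⟨f.hom ≫ g.hom, fun w n m a => by simp [f.map_op, g.map_op]⟩

/-- The underlying function of a morphism in degree `n`. -/
def ap {A B : EInftyAlg k} (f : A ⟶ B) (n : ℤ) (a : A.X.X n) : B.X.X n := (f.hom.f n).hom a

@[simp] lemma ap_id (A : EInftyAlg k) (n : ℤ) (a : A.X.X n) : ap (𝟙 A) n a = a := rfl

@[simp] lemma ap_comp {A B C : EInftyAlg k} (f : A ⟶ B) (g : B ⟶ C) (n : ℤ) (a : A.X.X n) :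
    ap (f ≫ g) n a = ap g n (ap f n a) := rfl

lemma hom_ext {A B : EInftyAlg k} {f g : A ⟶ B} (h : ∀ n a, ap f n a = ap g n a) : f = g := by
  apply Hom.ext
  ext n a
  exact h n a

/-- A function between the underlying graded sets is a morphism of `E_∞`-algebras. -/
structure IsAlgMap (A B : EInftyAlg k) (φ : ∀ n, A.X.X n → B.X.X n) : Prop where
  add : ∀ n a a', φ n (a + a') = φ n a + φ n a'
  smul : ∀ n (c : k) a, φ n (c • a) = c • φ n a
  d : ∀ i j a, φ j ((A.X.d i j).hom a) = (B.X.d i j).hom (φ i a)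
  op : ∀ {r d : ℕ} (w : Fin (d + 1) → Equiv.Perm (Fin r)) (n : Fin r → ℤ) (m : ℤ)
    (a : ∀ i, A.X.X (n i)), φ m (A.op w n m a) = B.op w n m (fun i => φ (n i) (a i))

lemma isAlgMap_ap {A B : EInftyAlg k} (f : A ⟶ B) : IsAlgMap A B (ap f) where
  add n a a' := map_add (f.hom.f n).hom a a'
  smul n c a := map_smul (f.hom.f n).hom c a
  d i j a := by
    have := f.hom.comm i j
    exact (congrArg (fun g => g.hom a) this).symm
  op w n m a := f.map_op w n m a

/-- The morphism given by a function as in `IsAlgMap`. -/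
def IsAlgMap.toHom {A B : EInftyAlg k} {φ : ∀ n, A.X.X n → B.X.X n} (h : IsAlgMap A B φ) :
    A ⟶ B where
  hom :=
    { f := fun n => ModuleCat.ofHom
        { toFun := φ n, map_add' := h.add n, map_smul' := fun c a => h.smul n c a }
      comm' := fun i j _ => by
        ext a
        exact (h.d i j a).symm }
  map_op w n m a := h.op w n m a

@[simp] lemma IsAlgMap.ap_toHom {A B : EInftyAlg k} {φ : ∀ n, A.X.X n → B.X.X n}
    (h : IsAlgMap A B φ) (n : ℤ) (a : A.X.X n) : ap h.toHom n a = φ n a := rfl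

/-- Weak equivalences: the quasi-isomorphisms. -/
def IsWeakEquivalence {A B : EInftyAlg k} (f : A ⟶ B) : Prop := QuasiIso f.hom

/-- Fibrations: the degreewise surjections. -/
def IsFibration {A B : EInftyAlg k} (f : A ⟶ B) : Prop :=
  ∀ n, Function.Surjective (ap f n)

/-- Cofibrant objects: morphisms out of them lift along all trivial fibrations. -/
def IsCofibrant (A : EInftyAlg k) : Prop :=
  ∀ ⦃B C : EInftyAlg k⦄ (p : B ⟶ C), IsFibration p → IsWeakEquivalence p →
    ∀ f : A ⟶ C, ∃ g : A ⟶ B, g ≫ p = f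

/-! ### Algebras given by generators and relations -/

/-- Formal expressions in generators `Γ` by the structure of an `E_∞`-algebra. -/
inductive Term (k : Type u) (Γ : ℤ → Type u) : ℤ → Type u
  | gen {n : ℤ} (g : Γ n) : Term k Γ n
  | zero (n : ℤ) : Term k Γ n
  | add {n : ℤ} (s t : Term k Γ n) : Term k Γ n
  | smul {n : ℤ} (c : k) (t : Term k Γ n) : Term k Γ n
  | d {i : ℤ} (j : ℤ) (t : Term k Γ i) : Term k Γ j
  | op {r d : ℕ} (w : Fin (d + 1) → Equiv.Perm (Fin r)) (n : Fin r → ℤ) (m : ℤ)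
      (t : ∀ i, Term k Γ (n i)) : Term k Γ m

/-- The value of an expression in an algebra, for given values of the generators. -/
def Term.eval {Γ : ℤ → Type u} (B : EInftyAlg k) (f : ∀ n, Γ n → B.X.X n) :
    ∀ {n : ℤ}, Term k Γ n → B.X.X n
  | _, .gen g => f _ g
  | _, .zero _ => 0
  | _, .add s t => s.eval B f + t.eval B f
  | _, .smul c t => c • t.eval B f
  | _, .d j t => (B.X.d _ j).hom (t.eval B f)
  | _, .op w n m t => B.op w n m (fun i => (t i).eval B f)

section Universal

variable {Γ : ℤ → Type u} (R : ∀ B : EInftyAlg k, (∀ n, Γ n → B.X.X n) → Prop)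

/-- Two expressions are identified if they have the same value in every algebra, for all values of
the generators that satisfy the relations `R`. -/
def termSetoid (n : ℤ) : Setoid (Term k Γ n) where
  r s t := ∀ (B : EInftyAlg k) (f : ∀ n, Γ n → B.X.X n), R B f → s.eval B f = t.eval B f
  iseqv := ⟨fun _ _ _ _ => rfl, fun h B f hf => (h B f hf).symm,
    fun h h' B f hf => (h B f hf).trans (h' B f hf)⟩

/-- Expressions in the generators modulo the relations. -/
def Univ (n : ℤ) : Type u := Quotient (termSetoid R n)

namespace Univ

variable {R}

/-- The value of a class of expressions. -/
def eval {B : EInftyAlg k} {f : ∀ n, Γ n → B.X.X n} (hf : R B f) {n : ℤ} :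
    Univ R n → B.X.X n :=
  Quotient.lift (fun t => t.eval B f) (fun _ _ h => h B f hf)

lemma ext {n : ℤ} {x y : Univ R n}
    (h : ∀ (B : EInftyAlg k) (f : ∀ n, Γ n → B.X.X n) (hf : R B f), eval hf x = eval hf y) :
    x = y := by
  induction x using Quotient.inductionOn with | h s =>
  induction y using Quotient.inductionOn with | h t =>
  exact Quotient.sound fun B f hf => h B f hf

/-- The class of an expression. -/
def mk {n : ℤ} (t : Term k Γ n) : Univ R n := Quotient.mk _ t

@[simp] lemma eval_mk {B : EInftyAlg k} {f : ∀ n, Γ n → B.X.X n} (hf : R B f) {n : ℤ}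
    (t : Term k Γ n) : eval hf (mk t) = t.eval B f := rfl

/-- The generators. -/
def gen {n : ℤ} (g : Γ n) : Univ R n := mk (.gen g)

@[simp] lemma eval_gen {B : EInftyAlg k} {f : ∀ n, Γ n → B.X.X n} (hf : R B f) {n : ℤ}
    (g : Γ n) : eval hf (gen g) = f n g := rfl

instance (n : ℤ) : Zero (Univ R n) := ⟨Quotient.mk _ (.zero n)⟩
noncomputable instance (n : ℤ) : Add (Univ R n) := ⟨fun x y => Quotient.mk _ (.add x.out y.out)⟩
noncomputable instance (n : ℤ) : SMul k (Univ R n) := ⟨fun c x => Quotient.mk _ (.smul c x.out)⟩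
noncomputable instance (n : ℤ) : Neg (Univ R n) := ⟨fun x => (-1 : k) • x⟩

/-- The differential on classes of expressions. -/
noncomputable def d (i j : ℤ) (x : Univ R i) : Univ R j := Quotient.mk _ (.d j x.out)

/-- The operations on classes of expressions. -/
noncomputable def op {r d : ℕ} (w : Fin (d + 1) → Equiv.Perm (Fin r)) (n : Fin r → ℤ) (m : ℤ)
    (x : ∀ i, Univ R (n i)) : Univ R m :=
  Quotient.mk _ (.op w n m fun i => (x i).out)

section

variable {B : EInftyAlg k} {f : ∀ n, Γ n → B.X.X n} (hf : R B f)

lemma eval_out {n : ℤ} (x : Univ R n) : (Quotient.out x).eval B f = eval hf x := by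
  conv_rhs => rw [← Quotient.out_eq x]
  rfl

@[simp] lemma eval_zero (n : ℤ) : eval hf (0 : Univ R n) = 0 := rfl

@[simp] lemma eval_add {n : ℤ} (x y : Univ R n) : eval hf (x + y) = eval hf x + eval hf y := by
  rw [← eval_out hf x, ← eval_out hf y]; rfl

@[simp] lemma eval_smul {n : ℤ} (c : k) (x : Univ R n) : eval hf (c • x) = c • eval hf x := by
  rw [← eval_out hf x]; rfl

@[simp] lemma eval_neg {n : ℤ} (x : Univ R n) : eval hf (-x) = -eval hf x := by
  change eval hf ((-1 : k) • x) = _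
  simp

@[simp] lemma eval_d (i j : ℤ) (x : Univ R i) :
    eval hf (d i j x) = (B.X.d i j).hom (eval hf x) := by
  rw [← eval_out hf x]; rfl

@[simp] lemma eval_op {r d : ℕ} (w : Fin (d + 1) → Equiv.Perm (Fin r)) (n : Fin r → ℤ) (m : ℤ)
    (x : ∀ i, Univ R (n i)) : eval hf (op w n m x) = B.op w n m (fun i => eval hf (x i)) := by
  have h : (fun i => eval hf (x i)) = fun i => (Quotient.out (x i)).eval B f :=
    funext fun i => (eval_out hf (x i)).symm
  rw [h]; rfl

end

noncomputable instance (n : ℤ) : AddCommGroup (Univ R n) where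
  add_assoc x y z := ext fun B f hf => by simp [add_assoc]
  zero_add x := ext fun B f hf => by simp
  add_zero x := ext fun B f hf => by simp
  add_comm x y := ext fun B f hf => by simp [add_comm]
  neg_add_cancel x := ext fun B f hf => by simp
  nsmul := nsmulRec
  zsmul := zsmulRec

noncomputable instance (n : ℤ) : Module k (Univ R n) where
  one_smul x := ext fun B f hf => by simp
  mul_smul c c' x := ext fun B f hf => by simp [mul_smul]
  smul_zero c := ext fun B f hf => by simp
  smul_add c x y := ext fun B f hf => by simp
  add_smul c c' x := ext fun B f hf => by simp [add_smul]
  zero_smul x := ext fun B f hf => by simp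

/-- Evaluation as a linear map. -/
noncomputable def evalₗ {B : EInftyAlg k} {f : ∀ n, Γ n → B.X.X n} (hf : R B f) (n : ℤ) :
    Univ R n →ₗ[k] B.X.X n where
  toFun := eval hf
  map_add' := eval_add hf
  map_smul' := eval_smul hf

@[simp] lemma eval_zsmul {B : EInftyAlg k} {f : ∀ n, Γ n → B.X.X n} (hf : R B f) {n : ℤ} (c : ℤ)
    (x : Univ R n) : eval hf (c • x) = c • eval hf x := map_zsmul (evalₗ hf n) c x

@[simp] lemma eval_sum {B : EInftyAlg k} {f : ∀ n, Γ n → B.X.X n} (hf : R B f) {n : ℤ} {ι : Type*}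
    (s : Finset ι) (x : ι → Univ R n) : eval hf (∑ i ∈ s, x i) = ∑ i ∈ s, eval hf (x i) :=
  map_sum (evalₗ hf n) x s

variable (R) in
/-- The underlying complex. -/
noncomputable def complex : ChainComplex (ModuleCat.{u} k) ℤ where
  X n := ModuleCat.of k (Univ R n)
  d i j := ModuleCat.ofHom
    { toFun := d i j
      map_add' := fun x y => ext fun B f hf => by simp
      map_smul' := fun c x => ext fun B f hf => by simp }
  shape i j h := by
    ext x
    exact ext fun B f hf => by
      change eval hf (d i j x) = 0
      rw [eval_d, B.X.shape i j h]; rfl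
  d_comp_d' i j l _ _ := by
    ext x
    exact ext fun B f hf => by
      change eval hf (d j l (d i j x)) = 0
      rw [eval_d, eval_d, ← ModuleCat.comp_apply, B.X.d_comp_d]; rfl

lemma eval_dSlot {B : EInftyAlg k} {f : ∀ n, Γ n → B.X.X n} (hf : R B f) (n : ℤ) (c : Bool)
    (x : Univ R n) :
    eval hf (dSlot (complex R) n c x : Univ R (bif c then n - 1 else n)) =
      dSlot B.X n c (eval hf x) := by
  cases c
  · rfl
  · exact eval_d hf _ _ x

/-- The operations as multilinear maps. -/
noncomputable def opₗ {r d : ℕ} (w : Fin (d + 1) → Equiv.Perm (Fin r)) (n : Fin r → ℤ) (m : ℤ) :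
    MultilinearMap k (fun i => Univ R (n i)) (Univ R m) where
  toFun := op w n m
  map_update_add' x i a b := ext fun B f hf => by
    simp only [eval_op, eval_add, Function.apply_update (fun i => eval hf (n := n i))]
    exact (B.op w n m).map_update_add _ _ _ _
  map_update_smul' x i c a := ext fun B f hf => by
    simp only [eval_op, eval_smul, Function.apply_update (fun i => eval hf (n := n i))]
    exact (B.op w n m).map_update_smul _ _ _ _

end Univ

/-- The `E_∞`-algebra with generators `Γ` and relations `R`. -/
noncomputable def univAlg : EInftyAlg k where
  X := Univ.complex R
  op w n m := Univ.opₗ w n m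
  op_shape w n m h := by
    ext x
    exact Univ.ext fun B f hf => by
      change Univ.eval hf (Univ.op w n m x) = 0
      rw [Univ.eval_op, B.op_shape w n m h]; rfl
  op_degenerate w n m h := by
    ext x
    exact Univ.ext fun B f hf => by
      change Univ.eval hf (Univ.op w n m x) = 0
      rw [Univ.eval_op, B.op_degenerate w n m h]; rfl
  d_op_zero w n m h a := Univ.ext fun B f hf => by
    refine (Univ.eval_d hf _ _ (Univ.op w n m a)).trans ?_
    refine (congrArg _ (Univ.eval_op hf w n m a)).trans ((B.d_op_zero w n m h _).trans ?_)
    refine Eq.trans ?_ (Univ.eval_sum hf _ _).symm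
    refine Finset.sum_congr rfl fun j _ => ?_
    refine Eq.trans ?_ (Univ.eval_zsmul hf _ _).symm
    refine congrArg _ (Eq.trans ?_ (Univ.eval_op hf _ _ _ _).symm)
    exact congrArg _ (funext fun i => (Univ.eval_dSlot hf _ _ (a i)).symm)
  d_op_succ w n m h a := Univ.ext fun B f hf => by
    refine (Univ.eval_d hf _ _ (Univ.op w n m a)).trans ?_
    refine (congrArg _ (Univ.eval_op hf w n m a)).trans ((B.d_op_succ w n m h _).trans ?_)
    refine Eq.trans ?_ (Univ.eval_add hf _ _).symm
    refine congrArg₂ _ ?_ ?_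
    · refine Eq.trans ?_ (Univ.eval_sum hf _ _).symm
      refine Finset.sum_congr rfl fun j _ => ?_
      refine Eq.trans ?_ (Univ.eval_zsmul hf _ _).symm
      exact congrArg _ (Univ.eval_op hf _ _ _ _).symm
    · refine Eq.trans ?_ (Univ.eval_sum hf _ _).symm
      refine Finset.sum_congr rfl fun j _ => ?_
      refine Eq.trans ?_ (Univ.eval_zsmul hf _ _).symm
      refine congrArg _ (Eq.trans ?_ (Univ.eval_op hf _ _ _ _).symm)
      exact congrArg _ (funext fun i => (Univ.eval_dSlot hf _ _ (a i)).symm)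
  op_unit n a := Univ.ext fun B f hf =>
    (Univ.eval_op hf _ _ _ (fun _ => a)).trans (B.op_unit n _)
  op_perm σ w n m a := Univ.ext fun B f hf => by
    refine (Univ.eval_op hf _ _ _ a).trans ?_
    rw [B.op_perm σ w n m]
    refine Eq.trans ?_ (Univ.eval_zsmul hf _ _).symm
    exact congrArg _ (Univ.eval_op hf _ _ _ _).symm
  op_comp w v n m a := Univ.ext fun B f hf => by
    refine (Univ.eval_op hf w _ m _).trans ?_
    refine Eq.trans (congrArg _ (funext fun i => Univ.eval_op hf (v i) (n i) _ (a i))) ?_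
    rw [B.op_comp w v n m]
    refine Eq.trans ?_ (Univ.eval_zsmul hf _ _).symm
    refine congrArg _ ?_
    refine Eq.trans ?_ (Univ.eval_sum hf _ _).symm
    refine Finset.sum_congr rfl fun x _ => ?_
    refine Eq.trans ?_ (Univ.eval_zsmul hf _ _).symm
    exact congrArg _ (Univ.eval_op hf _ _ _ _).symm

/-- The generators, as elements of the algebra. -/
def univGen (n : ℤ) (g : Γ n) : (univAlg R).X.X n := (Univ.gen g : Univ R n)

variable {R}

/-- The morphism out of an algebra given by generators and relations. -/
noncomputable def univDesc {B : EInftyAlg k} {f : ∀ n, Γ n → B.X.X n} (hf : R B f) :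
    univAlg R ⟶ B :=
  IsAlgMap.toHom (φ := fun n (x : Univ R n) => Univ.eval hf x)
    { add := fun _ x y => Univ.eval_add hf x y
      smul := fun _ c x => Univ.eval_smul hf c x
      d := fun i j x => Univ.eval_d hf i j x
      op := fun w n m x => Univ.eval_op hf w n m x }

@[simp] lemma ap_univDesc_gen {B : EInftyAlg k} {f : ∀ n, Γ n → B.X.X n} (hf : R B f) (n : ℤ)
    (g : Γ n) : ap (univDesc hf) n (univGen R n g) = f n g := rfl

/-- Equations in an algebra given by generators and relations may be checked after evaluation. -/
lemma univ_ext {n : ℤ} {x y : (univAlg R).X.X n}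
    (h : ∀ (B : EInftyAlg k) (f : ∀ n, Γ n → B.X.X n) (hf : R B f),
      ap (univDesc hf) n x = ap (univDesc hf) n y) : x = y :=
  Univ.ext h

/-- A morphism out of an algebra given by generators and relations is determined by its values on
the generators. -/
lemma univ_hom_ext {B : EInftyAlg k} {g h : univAlg R ⟶ B}
    (H : ∀ n (γ : Γ n), ap g n (univGen R n γ) = ap h n (univGen R n γ)) : g = h := by
  have key : ∀ {n : ℤ} (t : Term k Γ n),
      ap g n (Univ.mk (R := R) t) =
        ap h n (Univ.mk (R := R) t) := by
    intro n t
    induction t with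
    | gen γ => exact H _ γ
    | zero n =>
      exact ((g.hom.f n).hom.map_zero).trans ((h.hom.f n).hom.map_zero).symm
    | @add n s t hs ht =>
      have e : (Univ.mk (R := R) (s.add t)) =
          (Univ.mk (R := R) s) + (Univ.mk (R := R) t) :=
        Univ.ext fun B f hf => by rw [Univ.eval_add]; rfl
      rw [e]
      exact ((isAlgMap_ap g).add _ _ _).trans
        ((congrArg₂ _ hs ht).trans ((isAlgMap_ap h).add _ _ _).symm)
    | @smul n c t ht =>
      have e : (Univ.mk (R := R) (t.smul c)) =
          c • (Univ.mk (R := R) t) :=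
        Univ.ext fun B f hf => by rw [Univ.eval_smul]; rfl
      rw [e]
      exact ((isAlgMap_ap g).smul _ _ _).trans
        ((congrArg _ ht).trans ((isAlgMap_ap h).smul _ _ _).symm)
    | @d i j t ht =>
      have e : (Univ.mk (R := R) (t.d j)) =
          Univ.d i j (Univ.mk (R := R) t) :=
        Univ.ext fun B f hf => by rw [Univ.eval_d]; rfl
      rw [e]
      exact ((isAlgMap_ap g).d i j _).trans
        ((congrArg _ ht).trans ((isAlgMap_ap h).d i j _).symm)
    | @op r d w n m t ht =>
      have e : (Univ.mk (R := R) (Term.op w n m t)) =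
          Univ.op w n m (fun i => Univ.mk (R := R) (t i)) :=
        Univ.ext fun B f hf => by rw [Univ.eval_op]; rfl
      rw [e]
      exact ((isAlgMap_ap g).op w n m _).trans
        ((congrArg _ (funext ht)).trans ((isAlgMap_ap h).op w n m _).symm)
  apply hom_ext
  intro n x
  obtain ⟨t, rfl⟩ := Quotient.exists_rep (s := termSetoid R n) x
  exact key t

end Universal

/-! ### Colimits -/

section Colimits

variable {J : Type u} [Category.{u} J] (F : J ⥤ EInftyAlg k)

/-- A cocone under `F`, in terms of elements. -/
def IsCoconeMap (B : EInftyAlg k) (f : ∀ n, (Σ j, (F.obj j).X.X n) → B.X.X n) : Prop :=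
  (∀ j, IsAlgMap (F.obj j) B fun n a => f n ⟨j, a⟩) ∧
    ∀ (j j' : J) (φ : j ⟶ j') (n : ℤ) (a : (F.obj j).X.X n), f n ⟨j', ap (F.map φ) n a⟩ = f n ⟨j, a⟩

lemma isAlgMap_univGen (j : J) : IsAlgMap (F.obj j) (univAlg (IsCoconeMap F))
    fun n a => univGen (IsCoconeMap F) n ⟨j, a⟩ where
  add n a a' := univ_ext fun B f hf => by
    rw [(isAlgMap_ap (univDesc hf)).add]; exact (hf.1 j).add n a a'
  smul n c a := univ_ext fun B f hf => by
    rw [(isAlgMap_ap (univDesc hf)).smul]; exact (hf.1 j).smul n c a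
  d i i' a := univ_ext fun B f hf => by
    rw [(isAlgMap_ap (univDesc hf)).d]; exact (hf.1 j).d i i' a
  op w n m a := univ_ext fun B f hf => by
    rw [(isAlgMap_ap (univDesc hf)).op]; exact (hf.1 j).op w n m a

/-- The colimit cocone, by generators and relations. -/
noncomputable def colimCocone : Limits.Cocone F where
  pt := univAlg (IsCoconeMap F)
  ι :=
    { app := fun j => (isAlgMap_univGen F j).toHom
      naturality := fun j j' φ => hom_ext fun n a => univ_ext fun _ _ hf =>
        hf.2 j j' φ n a }

/-- The universal property of the colimit cocone. -/
noncomputable def colimCoconeIsColimit : Limits.IsColimit (colimCocone F) where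
  desc s := univDesc (R := IsCoconeMap F) (f := fun n a => ap (s.ι.app a.1) n a.2)
    ⟨fun j => isAlgMap_ap (s.ι.app j), fun j j' φ n a => by
      change ap (F.map φ ≫ s.ι.app j') n a = ap (s.ι.app j) n a
      rw [s.w φ]⟩
  fac s j := rfl
  uniq s m h := univ_hom_ext fun n a => by
    change ap ((colimCocone F).ι.app a.1 ≫ m) n a.2 = _
    rw [h]; rfl

end Colimits

instance : Limits.HasColimits (EInftyAlg k) where
  has_colimits_of_shape _ _ :=
    { has_colimit := fun F => ⟨⟨⟨colimCocone F, colimCoconeIsColimit F⟩⟩⟩ }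

/-! ### The tensoring over simplicial sets -/

instance (q p : ℕ) : Finite (SimplexCategory.mk q ⟶ SimplexCategory.mk p) :=
  Finite.of_injective (fun θ => fun t => θ.toOrderHom t) fun θ θ' h => by
    ext t : 3
    exact congrFun h t

noncomputable instance (q p : ℕ) : Fintype (SimplexCategory.mk q ⟶ SimplexCategory.mk p) :=
  Fintype.ofFinite _

/-- The `p`-simplices of a simplicial set. -/
abbrev Simplices (K : SSet.{u}) (p : ℕ) : Type u := K.obj (Opposite.op (SimplexCategory.mk p))

/-- The morphisms from `A` to `B` parametrized by a simplicial set `K`, that is, the morphisms of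
`E_∞`-algebras from `A` to the cotensor `B^K = Hom(N_*(K), B)`, on which the Barratt–Eccles operad
acts through its diagonal (the Alexander–Whitney map) and its action on the normalized chains
`N_*(K)`. They are given here by the values `F x a` on `p`-simplices `x` of `K` and
elements `a` of `A` of degree `m`; they lie in degree `p + m` (in any other degree `l` the value is
set to zero). -/
structure IsParamMap (K : SSet.{u}) (A B : EInftyAlg k)
    (F : ∀ (p : ℕ) (_ : Simplices K p) (m l : ℤ), A.X.X m → B.X.X l) :
    Prop where
  shape : ∀ (p : ℕ) x (m l : ℤ) a, l ≠ p + m → F p x m l a = 0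
  add : ∀ (p : ℕ) x m l a a', F p x m l (a + a') = F p x m l a + F p x m l a'
  smul : ∀ (p : ℕ) x m l (c : k) a, F p x m l (c • a) = c • F p x m l a
  degenerate : ∀ (p : ℕ) (i : Fin (p + 1)) (y : Simplices K p) m l a,
    F (p + 1) (K.map (SimplexCategory.σ i).op y) m l a = 0
  d_zero : ∀ x (m : ℤ) a,
    (B.X.d m (m - 1)).hom (F 0 x m m a) = F 0 x (m - 1) (m - 1) ((A.X.d m (m - 1)).hom a)
  d_succ : ∀ (p : ℕ) x (m l : ℤ) a, l = (p + 1 : ℕ) + m →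
    (B.X.d l (l - 1)).hom (F (p + 1) x m l a) =
      ∑ i : Fin (p + 2), ((-1 : ℤ) ^ (i : ℕ)) •
        F p (K.map (SimplexCategory.δ i).op x) m (l - 1) a +
      ((-1 : ℤ) ^ (p + 1)) • F (p + 1) x (m - 1) (l - 1) ((A.X.d m (m - 1)).hom a)
  op : ∀ (p : ℕ) x {r d : ℕ} (w : Fin (d + 1) → Equiv.Perm (Fin r)) (n : Fin r → ℤ) (m l : ℤ)
    (a : ∀ i, A.X.X (n i)), m = d + ∑ i, n i → l = p + m →
    F p x m l (A.op w n m a) =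
      ((-1 : ℤ) ^ (p * d)) •
        ∑ j : Fin (d + 1), ∑ q : Fin r → Fin (p + 1),
          ∑ θ : ∀ i, SimplexCategory.mk (q i) ⟶ SimplexCategory.mk p,
            (coactionCoeff ((toLists w).drop j) p (fun i => mapValues (θ i)) *
              ((∑ i : Fin r, ∑ i' : Fin r,
                if i' < i then (q i : ℤ) * n i' else 0).negOnePow : ℤ)) •
              B.op (front w j) (fun i => q i + n i) l
                (fun i => F (q i) (K.map (θ i).op x) (n i) (q i + n i) (a i))

lemma IsParamMap.comp {K : SSet.{u}} {A B C : EInftyAlg k}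
    {F : ∀ (p : ℕ) (_ : Simplices K p) (m l : ℤ), A.X.X m → B.X.X l}
    (hF : IsParamMap K A B F) (g : B ⟶ C) :
    IsParamMap K A C (fun p x m l a => ap g l (F p x m l a)) where
  shape p x m l a h := by rw [hF.shape p x m l a h]; exact map_zero (g.hom.f l).hom
  add p x m l a a' := by rw [hF.add, (isAlgMap_ap g).add]
  smul p x m l c a := by rw [hF.smul, (isAlgMap_ap g).smul]
  degenerate p i y m l a := by rw [hF.degenerate]; exact map_zero (g.hom.f l).hom
  d_zero x m a := by rw [← (isAlgMap_ap g).d, hF.d_zero]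
  d_succ p x m l a h := by
    rw [← (isAlgMap_ap g).d, hF.d_succ p x m l a h]
    simp only [ap, map_add, map_sum, map_zsmul]
  op p x r d w n m l a h h' := by
    rw [hF.op p x w n m l a h h']
    simp only [ap, map_zsmul, map_sum]
    refine congrArg _ (Finset.sum_congr rfl fun j _ => Finset.sum_congr rfl fun q _ =>
      Finset.sum_congr rfl fun θ _ => congrArg _ ?_)
    exact g.map_op _ _ _ _

/-- Change of parameters: precomposition with a simplicial map and with a family of morphisms that
is constant on the components of the parameter space. -/
lemma IsParamMap.precomp {K L : SSet.{u}} {A B C : EInftyAlg k}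
    {F : ∀ (p : ℕ) (_ : Simplices L p) (m l : ℤ), B.X.X m → C.X.X l}
    (hF : IsParamMap L B C F) (f : K ⟶ L) (g : ∀ U, K.obj U → (A ⟶ B))
    (hg : ∀ ⦃U V⦄ (φ : U ⟶ V) (x : K.obj U), g V (K.map φ x) = g U x) :
    IsParamMap K A C (fun p x m l a => F p (f.app _ x) m l (ap (g _ x) m a)) where
  shape p x m l a h := hF.shape _ _ _ _ _ h
  add p x m l a a' := by rw [(isAlgMap_ap _).add, hF.add]
  smul p x m l c a := by rw [(isAlgMap_ap _).smul, hF.smul]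
  degenerate p i y m l a := by rw [NatTrans.naturality_apply, hF.degenerate]
  d_zero x m a := by rw [hF.d_zero, (isAlgMap_ap _).d]
  d_succ p x m l a h := by
    rw [hF.d_succ _ _ _ _ _ h, (isAlgMap_ap _).d]
    simp only [hg, NatTrans.naturality_apply]
  op p x r d w n m l a h h' := by
    rw [(isAlgMap_ap _).op, hF.op _ _ _ _ _ _ _ h h']
    simp only [hg, NatTrans.naturality_apply]

/-- The relations that define `K ⊗ A`. -/
def TensorRel (K : SSet.{u}) (A B : EInftyAlg k)
    (f : ∀ l : ℤ, (Σ (p : ℕ) (m : ℤ), Simplices K p × A.X.X m) → B.X.X l) :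
    Prop :=
  IsParamMap K A B fun p x m l a => f l ⟨p, m, x, a⟩

/-- The tensoring of `E_∞`-algebras over simplicial sets: morphisms from `K ⊗ A` to `B` are the
morphisms from `A` to `B` parametrized by `K`, that is, the morphisms from `A` to `B^K`. -/
noncomputable def tensor (K : SSet.{u}) (A : EInftyAlg k) : EInftyAlg k := univAlg (TensorRel K A)

/-- The element `x ⊗ a` of `K ⊗ A`. -/
def tmul (K : SSet.{u}) (A : EInftyAlg k) (p : ℕ) (x : Simplices K p)
    (m l : ℤ) (a : A.X.X m) : (tensor K A).X.X l := univGen (TensorRel K A) l ⟨p, m, x, a⟩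

/-- The morphism out of `K ⊗ A` given by a parametrized morphism. -/
noncomputable def tensorDesc {K : SSet.{u}} {A B : EInftyAlg k}
    {F : ∀ (p : ℕ) (_ : Simplices K p) (m l : ℤ), A.X.X m → B.X.X l}
    (hF : IsParamMap K A B F) : tensor K A ⟶ B :=
  univDesc (R := TensorRel K A) (f := fun l z => F z.1 z.2.2.1 z.2.1 l z.2.2.2) hF

@[simp] lemma tensorDesc_tmul {K : SSet.{u}} {A B : EInftyAlg k}
    {F : ∀ (p : ℕ) (_ : Simplices K p) (m l : ℤ), A.X.X m → B.X.X l}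
    (hF : IsParamMap K A B F) (p x m l a) :
    ap (tensorDesc hF) l (tmul K A p x m l a) = F p x m l a := rfl

lemma tensor_hom_ext {K : SSet.{u}} {A B : EInftyAlg k} {g h : tensor K A ⟶ B}
    (H : ∀ p x m l a, ap g l (tmul K A p x m l a) = ap h l (tmul K A p x m l a)) : g = h :=
  univ_hom_ext fun _ z => H z.1 z.2.2.1 z.2.1 _ z.2.2.2

lemma tensor_ext {K : SSet.{u}} {A : EInftyAlg k} {l : ℤ} {y z : (tensor K A).X.X l}
    (H : ∀ (B : EInftyAlg k) (F : ∀ (p : ℕ) (_ : Simplices K p) (m l : ℤ), A.X.X m → B.X.X l)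
      (hF : IsParamMap K A B F), ap (tensorDesc hF) l y = ap (tensorDesc hF) l z) : y = z :=
  univ_ext fun B f hf => H B (fun p x m l a => f l ⟨p, m, x, a⟩) hf

/-- The universal parametrized morphism `A → (K ⊗ A)^K`. -/
lemma isParamMap_tmul (K : SSet.{u}) (A : EInftyAlg k) :
    IsParamMap K A (tensor K A) (tmul K A) where
  shape p x m l a h := tensor_ext fun B F hF =>
    (hF.shape p x m l a h).trans (map_zero ((tensorDesc hF).hom.f l).hom).symm
  add p x m l a a' := tensor_ext fun B F hF => by
    rw [(isAlgMap_ap (tensorDesc hF)).add]; exact hF.add p x m l a a'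
  smul p x m l c a := tensor_ext fun B F hF => by
    rw [(isAlgMap_ap (tensorDesc hF)).smul]; exact hF.smul p x m l c a
  degenerate p i y m l a := tensor_ext fun B F hF =>
    (hF.degenerate p i y m l a).trans (map_zero ((tensorDesc hF).hom.f l).hom).symm
  d_zero x m a := tensor_ext fun B F hF =>
    ((isAlgMap_ap (tensorDesc hF)).d _ _ _).trans (hF.d_zero x m a)
  d_succ p x m l a h := tensor_ext fun B F hF => by
    refine ((isAlgMap_ap (tensorDesc hF)).d _ _ _).trans ((hF.d_succ p x m l a h).trans ?_)
    simp only [ap, map_add, map_sum, map_zsmul]; rfl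
  op p x r d w n m l a h h' := tensor_ext fun B F hF => by
    refine (hF.op p x w n m l a h h').trans ?_
    simp only [ap, map_zsmul, map_sum]
    refine congrArg _ (Finset.sum_congr rfl fun j _ => Finset.sum_congr rfl fun q _ =>
      Finset.sum_congr rfl fun θ _ => congrArg _ ?_)
    exact ((tensorDesc hF).map_op (front w j) (fun i => q i + n i) l
      (fun i => tmul K A (q i) (K.map (θ i).op x) (n i) (q i + n i) (a i))).symm

/-- The functoriality of the tensoring: `x ⊗ a ↦ f x ⊗ g x a`, where the morphism `g x : A ⟶ B` may
depend on the connected component of the simplex `x`. -/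
noncomputable def tensorMap {K L : SSet.{u}} {A B : EInftyAlg k} (f : K ⟶ L)
    (g : ∀ U, K.obj U → (A ⟶ B))
    (hg : ∀ ⦃U V⦄ (φ : U ⟶ V) (x : K.obj U), g V (K.map φ x) = g U x) :
    tensor K A ⟶ tensor L B :=
  tensorDesc ((isParamMap_tmul L B).precomp f g hg)

@[simp] lemma tensorMap_tmul {K L : SSet.{u}} {A B : EInftyAlg k} (f : K ⟶ L)
    (g : ∀ U, K.obj U → (A ⟶ B))
    (hg : ∀ ⦃U V⦄ (φ : U ⟶ V) (x : K.obj U), g V (K.map φ x) = g U x) (p x m l a) :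
    ap (tensorMap f g hg) l (tmul K A p x m l a) =
      tmul L B p (f.app _ x) m l (ap (g _ x) m a) := rfl

end EInftyAlg

/-! ## Spaces with group action and principal bundles -/

/-- A simplicial set with right `G`-action, as a functor from the groupoid `⋆ // Gᵒᵖ`; the morphism
`op g` acts by `p ↦ p · g`. -/
abbrev RightGSpace (G : Type u) [Group G] : Type (u + 1) := SingleObj Gᵐᵒᵖ ⥤ SSet.{u}

/-- A `G`-equivariant `E_∞`-algebra: a functor `⋆ // G ⥤ E_∞-Alg`. -/
abbrev EquivariantAlg (k : Type u) [Field k] (G : Type u) [Group G] : Type (u + 1) :=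
  SingleObj G ⥤ EInftyAlg k

namespace RightGSpace

variable {G : Type u} [Group G]

/-- The underlying simplicial set. -/
abbrev space (P : RightGSpace G) : SSet.{u} := P.obj (SingleObj.star _)

/-- The action of a group element. -/
abbrev act (P : RightGSpace G) (g : G) : P.space ⟶ P.space :=
  P.map (SingleObj.toEnd Gᵐᵒᵖ (MulOpposite.op g))

end RightGSpace

/-- A principal `G`-bundle over a simplicial set `Y`, for a discrete group `G`: a simplicial set
over `Y` with a right `G`-action that is free and transitive on the (nonempty) fibres. -/
structure PrincipalBundle (G : Type u) [Group G] (Y : SSet.{u}) where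
  total : RightGSpace G
  proj : total.space ⟶ Y
  act_proj : ∀ g : G, total.act g ≫ proj = proj
  surjective : ∀ U, Function.Surjective (proj.app U)
  torsor : ∀ U (p p' : total.space.obj U), proj.app U p = proj.app U p' →
    ∃! g : G, (total.act g).app U p = p'

namespace PrincipalBundle

variable {G : Type u} [Group G] {X Y : SSet.{u}}

/-- An isomorphism of principal bundles over the same base. -/
structure Iso (P P' : PrincipalBundle G Y) where
  iso : P.total ≅ P'.total
  comm : iso.hom.app (SingleObj.star _) ≫ P'.proj = P.proj

/-- The fibre product `X ×_Y P`. -/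
def pullbackSpace (Φ : X ⟶ Y) (P : PrincipalBundle G Y) : SSet.{u} where
  obj U := {z : X.obj U × P.total.space.obj U // Φ.app U z.1 = P.proj.app U z.2}
  map φ := ↾fun z => ⟨(X.map φ z.1.1, P.total.space.map φ z.1.2), by
    rw [NatTrans.naturality_apply, NatTrans.naturality_apply, z.2]⟩

/-- The fibre product `X ×_Y P` with the action of `G` on `P`. -/
def pullbackTotal (Φ : X ⟶ Y) (P : PrincipalBundle G Y) : RightGSpace G where
  obj _ := pullbackSpace Φ P
  map g :=
    { app := fun U => ↾fun z => ⟨(z.1.1, (P.total.map g).app U z.1.2), by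
        have h : P.proj.app U ((P.total.map g).app U z.1.2) = P.proj.app U z.1.2 :=
          congrArg (fun f : P.total.space ⟶ Y => f.app U z.1.2) (P.act_proj (MulOpposite.unop g))
        rw [h, z.2]⟩
      naturality := fun U V φ => by
        ext z
        refine Subtype.ext (Prod.ext rfl ?_)
        exact NatTrans.naturality_apply (P.total.map g) φ z.1.2 }
  map_id _ := by
    ext U z
    refine Subtype.ext (Prod.ext rfl ?_)
    exact congrArg (fun f : P.total.space ⟶ P.total.space => f.app U z.1.2) (P.total.map_id _)
  map_comp g h := by
    ext U z
    refine Subtype.ext (Prod.ext rfl ?_)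
    exact congrArg (fun f : P.total.space ⟶ P.total.space => f.app U z.1.2) (P.total.map_comp g h)

/-- The pullback bundle `Φ^* P = X ×_Y P` over `X`. -/
def pullback (Φ : X ⟶ Y) (P : PrincipalBundle G Y) : PrincipalBundle G X where
  total := pullbackTotal Φ P
  proj := { app := fun U => ↾fun z => z.1.1 }
  act_proj g := rfl
  surjective U x := by
    obtain ⟨p, hp⟩ := P.surjective U (Φ.app U x)
    exact ⟨⟨(x, p), hp.symm⟩, rfl⟩
  torsor U z z' h := by
    have h' : z.1.1 = z'.1.1 := h
    obtain ⟨g, hg, huniq⟩ := P.torsor U z.1.2 z'.1.2 (by rw [← z.2, ← z'.2, h'])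
    exact ⟨g, Subtype.ext (Prod.ext h' hg),
      fun g' hg' => huniq g' (congrArg (fun y => y.1.2) hg')⟩

/-- The canonical `G`-equivariant projection `Φ^* P ⟶ P`. -/
def pullbackProj (Φ : X ⟶ Y) (P : PrincipalBundle G Y) : (P.pullback Φ).total ⟶ P.total where
  app _ := { app := fun U => ↾fun z => z.1.2 }

/-- Two principal bundles over `X` lie in the same orbit of the mapping class group of `X`, which
acts on isomorphism classes of bundles by pullback along automorphisms of `X`. -/
def SameMappingClassOrbit (P P' : PrincipalBundle G X) : Prop :=
  ∃ Φ : X ≅ X, Nonempty (Iso (P.pullback Φ.hom) P')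

end PrincipalBundle

/-! ## Equivariant higher Hochschild chains -/

namespace EquivariantAlg

variable {k : Type u} [Field k] {G : Type u} [Group G]

/-- The underlying algebra. -/
abbrev alg (A : EquivariantAlg k G) : EInftyAlg k := A.obj (SingleObj.star _)

/-- The action of a group element. -/
abbrev act (A : EquivariantAlg k G) (g : G) : A.alg ⟶ A.alg := A.map (SingleObj.toEnd G g)

/-- A cofibrant replacement of `A` as an `E_∞`-algebra, on which `G` acts compatibly. -/
structure CofibrantReplacement (A : EquivariantAlg k G) where
  Q : EquivariantAlg k G
  q : Q ⟶ A
  cofibrant : Q.alg.IsCofibrant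
  weakEquivalence : EInftyAlg.IsWeakEquivalence (q.app (SingleObj.star _))

end EquivariantAlg

namespace RightGSpace

variable {k : Type u} [Field k] {G : Type u} [Group G]

/-- The group element on the edge from `i` to `j` of a string of arrows in `⋆ // G`. -/
def edge {n : ℕ} (σ : ComposableArrows (SingleObj G) n) {i j : Fin (n + 1)} (h : i ≤ j) : G :=
  σ.map (homOfLE h)

lemma edge_self {n : ℕ} (σ : ComposableArrows (SingleObj G) n) (i : Fin (n + 1)) :
    edge σ (le_refl i) = 1 := σ.map_id i

lemma edge_mul {n : ℕ} (σ : ComposableArrows (SingleObj G) n) {i j l : Fin (n + 1)} (h : i ≤ j)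
    (h' : j ≤ l) : edge σ h' * edge σ h = edge σ (h.trans h') :=
  (σ.map_comp (homOfLE h) (homOfLE h')).symm

lemma act_one (P : RightGSpace G) : P.act 1 = 𝟙 _ := P.map_id _

lemma act_mul (P : RightGSpace G) (g h : G) : P.act (g * h) = P.act g ≫ P.act h :=
  P.map_comp (X := SingleObj.star _) (Y := SingleObj.star _) (Z := SingleObj.star _) _ _

lemma _root_.EquivariantAlg.act_one (A : EquivariantAlg k G) : A.act 1 = 𝟙 _ := A.map_id _

lemma _root_.EquivariantAlg.act_mul (A : EquivariantAlg k G) (g h : G) :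
    A.act (g * h) = A.act h ≫ A.act g :=
  A.map_comp (X := SingleObj.star _) (Y := SingleObj.star _) (Z := SingleObj.star _) _ _

/-- The strings `⋆ → ⋯ → ⋆` of `m` composable arrows in `⋆ // G`, that is, the set `G^m`. -/
abbrev Strings (G : Type u) [Group G] (m : SimplexCategory) : Type u :=
  (nerve (SingleObj G)).obj (op m)

/-- The simplicial structure on strings of arrows. -/
abbrev restrict {m m' : SimplexCategory} (θ : m' ⟶ m) (σ : Strings G m) : Strings G m' :=
  (nerve (SingleObj G)).map θ.op σ

/-- The group element on the edge from the initial vertex to the image of the initial one. -/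
def initialEdge {m m' : SimplexCategory} (θ : m' ⟶ m) (σ : Strings G m) : G :=
  edge σ (Fin.zero_le (θ.toOrderHom 0))

/-- The group element on the edge from the image of the final vertex to the final one. -/
def finalEdge {m m' : SimplexCategory} (θ : m' ⟶ m) (σ : Strings G m) : G :=
  edge σ (Fin.le_last (θ.toOrderHom (Fin.last _)))

lemma initialEdge_id {m : SimplexCategory} (σ : Strings G m) : initialEdge (𝟙 m) σ = 1 :=
  edge_self σ 0

lemma finalEdge_id {m : SimplexCategory} (σ : Strings G m) : finalEdge (𝟙 m) σ = 1 :=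
  edge_self σ (Fin.last _)

lemma initialEdge_comp {m m' m'' : SimplexCategory} (θ : m' ⟶ m) (θ' : m'' ⟶ m')
    (σ : Strings G m) :
    initialEdge (θ' ≫ θ) σ = initialEdge θ' (restrict θ σ) * initialEdge θ σ :=
  (edge_mul σ (Fin.zero_le _) (θ.toOrderHom.monotone (Fin.zero_le _))).symm

lemma finalEdge_comp {m m' m'' : SimplexCategory} (θ : m' ⟶ m) (θ' : m'' ⟶ m')
    (σ : Strings G m) :
    finalEdge (θ' ≫ θ) σ = finalEdge θ σ * finalEdge θ' (restrict θ σ) :=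
  (edge_mul σ (θ.toOrderHom.monotone (Fin.le_last _)) (Fin.le_last _)).symm

/-- The standard simplices `Δ[n]`, as a functor. -/
def stdSimplices : SimplexCategory ⥤ SSet.{u} := SSet.stdSimplex.{u}

/-- The simplicial set `P × Δ[n] × G^m`, with the discrete simplicial set `G^m`. -/
def barSpace (P : RightGSpace G) (m n : SimplexCategory) : SSet.{u} where
  obj U := P.space.obj U × (stdSimplices.{u}.obj n).obj U × Strings G m
  map φ := ↾fun z => (P.space.map φ z.1, (stdSimplices.obj n).map φ z.2.1, z.2.2)

/-- The map `(p, s, σ) ↦ (f (p · g), ψ s, θ^* σ)`, where `g` is the final edge. -/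
def barSpaceMap {P P' : RightGSpace G} (f : P ⟶ P') {m m' n n' : SimplexCategory} (θ : m' ⟶ m)
    (ψ : n ⟶ n') : P.barSpace m n ⟶ P'.barSpace m' n' where
  app U := ↾fun z => ((f.app (SingleObj.star _)).app U ((P.act (finalEdge θ z.2.2)).app U z.1),
    (stdSimplices.map ψ).app U z.2.1, restrict θ z.2.2)
  naturality U V φ := by
    ext z
    refine Prod.ext ?_ (Prod.ext ?_ rfl)
    · exact (congrArg _ (NatTrans.naturality_apply (P.act (finalEdge θ z.2.2)) φ z.1)).trans
        (NatTrans.naturality_apply (f.app (SingleObj.star _)) φ _)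
    · exact NatTrans.naturality_apply (stdSimplices.map ψ) φ z.2.1

/-- The structure maps of the two-sided bar construction,
`(p, s, σ) ⊗ a ↦ (f (p · g), ψ s, θ^* σ) ⊗ h a`, where `g` is the final and `h` the initial
edge of `θ` in `σ`. -/
noncomputable def barMap (A : EquivariantAlg k G) {P P' : RightGSpace G} (f : P ⟶ P')
    {m m' n n' : SimplexCategory} (θ : m' ⟶ m) (ψ : n ⟶ n') :
    EInftyAlg.tensor (P.barSpace m n) A.alg ⟶ EInftyAlg.tensor (P'.barSpace m' n') A.alg :=
  EInftyAlg.tensorMap (barSpaceMap f θ ψ) (fun _ z => A.act (initialEdge θ z.2.2))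
    (fun _ _ _ _ => rfl)

lemma barMap_tmul (A : EquivariantAlg k G) {P P' : RightGSpace G} (f : P ⟶ P')
    {m m' n n' : SimplexCategory} (θ : m' ⟶ m) (ψ : n ⟶ n') (p : ℕ)
    (x : EInftyAlg.Simplices (P.barSpace m n) p) (l l' : ℤ) (a : A.alg.X.X l) :
    EInftyAlg.ap (barMap A f θ ψ) l' (EInftyAlg.tmul (P.barSpace m n) A.alg p x l l' a) =
      EInftyAlg.tmul (P'.barSpace m' n') A.alg p ((barSpaceMap f θ ψ).app _ x) l l'
        (EInftyAlg.ap (A.act (initialEdge θ x.2.2)) l a) := rfl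

lemma barMap_id (A : EquivariantAlg k G) (P : RightGSpace G) (m n : SimplexCategory) :
    barMap A (𝟙 P) (𝟙 m) (𝟙 n) = 𝟙 _ := by
  refine EInftyAlg.tensor_hom_ext fun p x l l' a => ?_
  have h1 : (barSpaceMap (𝟙 P) (𝟙 m) (𝟙 n)).app _ x = x := by
    refine Prod.ext ?_ (Prod.ext ?_ rfl)
    · change (P.act (finalEdge (𝟙 m) x.2.2)).app _ x.1 = x.1
      rw [finalEdge_id, act_one]; rfl
    · change (stdSimplices.map (𝟙 n)).app _ x.2.1 = x.2.1
      rw [CategoryTheory.Functor.map_id]; rfl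
  have h2 : A.act (initialEdge (𝟙 m) x.2.2) = 𝟙 _ := by
    rw [initialEdge_id, EquivariantAlg.act_one]
  rw [barMap_tmul, h1, h2, EInftyAlg.ap_id, EInftyAlg.ap_id]

lemma barMap_comp (A : EquivariantAlg k G) {P P' P'' : RightGSpace G} (f : P ⟶ P') (f' : P' ⟶ P'')
    {m m' m'' n n' n'' : SimplexCategory} (θ : m' ⟶ m) (θ' : m'' ⟶ m') (ψ : n ⟶ n')
    (ψ' : n' ⟶ n'') :
    barMap A f θ ψ ≫ barMap A f' θ' ψ' = barMap A (f ≫ f') (θ' ≫ θ) (ψ ≫ ψ') := by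
  refine EInftyAlg.tensor_hom_ext fun p x l l' a => ?_
  have h1 : (barSpaceMap f' θ' ψ').app _ ((barSpaceMap f θ ψ).app _ x) =
      (barSpaceMap (f ≫ f') (θ' ≫ θ) (ψ ≫ ψ')).app _ x := by
    refine Prod.ext ?_ (Prod.ext ?_ ?_)
    · have e := congrArg
        (fun F : P.space ⟶ P'.space => F.app (op (SimplexCategory.mk p))
          ((P.act (finalEdge θ x.2.2)).app _ x.1))
        (f.naturality (SingleObj.toEnd Gᵐᵒᵖ (MulOpposite.op (finalEdge θ' (restrict θ x.2.2)))))
      change (f'.app _).app _ ((P'.act (finalEdge θ' (restrict θ x.2.2))).app _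
        ((f.app _).app _ ((P.act (finalEdge θ x.2.2)).app _ x.1))) =
        (f'.app _).app _ ((f.app _).app _ ((P.act (finalEdge (θ' ≫ θ) x.2.2)).app _ x.1))
      rw [finalEdge_comp, act_mul]
      exact congrArg _ e.symm
    · change (stdSimplices.map ψ').app _ ((stdSimplices.map ψ).app _ x.2.1) =
        (stdSimplices.map (ψ ≫ ψ')).app _ x.2.1
      rw [CategoryTheory.Functor.map_comp]; rfl
    · rfl
  have h2 : A.act (initialEdge (θ' ≫ θ) x.2.2) =
      A.act (initialEdge θ x.2.2) ≫ A.act (initialEdge θ' (restrict θ x.2.2)) := by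
    rw [initialEdge_comp, EquivariantAlg.act_mul]
  rw [EInftyAlg.ap_comp, barMap_tmul, barMap_tmul, barMap_tmul, h1, h2, EInftyAlg.ap_comp]
  rfl

/-- The bifunctor `([m], [n]) ↦ (P × Δ[n] × G^m) ⊗ A`, contravariant in `[m]` through the two-sided
bar construction and covariant in `[n]`; it is functorial in `P`. -/
noncomputable def bar (A : EquivariantAlg k G) :
    RightGSpace G ⥤ SimplexCategoryᵒᵖ ⥤ SimplexCategory ⥤ EInftyAlg k where
  obj P :=
    { obj := fun m =>
        { obj := fun n => EInftyAlg.tensor (P.barSpace m.unop n) A.alg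
          map := fun ψ => barMap A (𝟙 P) (𝟙 m.unop) ψ
          map_id := fun n => barMap_id A P m.unop n
          map_comp := fun ψ ψ' => by rw [barMap_comp, Category.comp_id, Category.comp_id] }
      map := fun θ =>
        { app := fun n => barMap A (𝟙 P) θ.unop (𝟙 n)
          naturality := fun n n' ψ => by
            simp only [barMap_comp, Category.comp_id, Category.id_comp] }
      map_id := fun m => by
        ext n
        exact barMap_id A P m.unop n
      map_comp := fun θ θ' => by
        ext n
        simp only [NatTrans.comp_app, barMap_comp, Category.comp_id, unop_comp] }
  map f :=
    { app := fun m =>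
        { app := fun n => barMap A f (𝟙 m.unop) (𝟙 n)
          naturality := fun n n' ψ => by
            simp only [barMap_comp, Category.comp_id, Category.id_comp] }
      naturality := fun m m' θ => by
        ext n
        simp only [NatTrans.comp_app, barMap_comp, Category.comp_id, Category.id_comp] }
  map_id P := by
    ext m n
    exact barMap_id A P m.unop n
  map_comp f f' := by
    ext m n
    simp only [NatTrans.comp_app, barMap_comp, Category.comp_id]

/-- The derived tensor product `P ⊗^𝕃_G A`, functorial in the right `G`-space `P`: the coend
`∫^n (P × Δ[n] × G^n) ⊗ QA` of the bar construction, for a cofibrant replacement `QA` of `A`. -/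
noncomputable def derivedTensor {A : EquivariantAlg k G}
    (R : EquivariantAlg.CofibrantReplacement A) : RightGSpace G ⥤ EInftyAlg k :=
  bar R.Q ⋙ Limits.coendFunctor SimplexCategory (EInftyAlg k)

end RightGSpace

namespace PrincipalBundle

variable {k : Type u} [Field k] {G : Type u} [Group G] {X : SSet.{u}}

/-- The equivariant higher Hochschild chains `∫_P A = P ⊗^𝕃_G A` of a principal `G`-bundle `P` with
coefficients in a `G`-equivariant `E_∞`-algebra `A` (with chosen cofibrant replacement). -/
noncomputable def hochschild (P : PrincipalBundle G X) {A : EquivariantAlg k G}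
    (R : EquivariantAlg.CofibrantReplacement A) : EInftyAlg k :=
  (RightGSpace.derivedTensor R).obj P.total

/-- The morphism `∫_{Φ^* P} A ⟶ ∫_P A` induced by the canonical projection `Φ^* P ⟶ P`. -/
noncomputable def hochschildMap {Y : SSet.{u}} (Φ : X ⟶ Y) (P : PrincipalBundle G Y)
    {A : EquivariantAlg k G} (R : EquivariantAlg.CofibrantReplacement A) :
    (P.pullback Φ).hochschild R ⟶ P.hochschild R :=
  (RightGSpace.derivedTensor R).map (P.pullbackProj Φ)

end PrincipalBundle

/-! `∫_P A` is functorial in the right `G`-space underlying `P`, so it suffices that the projection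
`Φ^* P ⟶ P`, a base change of `Φ` in every simplicial degree, is an isomorphism. -/

namespace PrincipalBundle

variable {G : Type u} [Group G] {X Y : SSet.{u}}

lemma bijective_pullbackProj_app {Φ : X ⟶ Y} (P : PrincipalBundle G Y) {U : SimplexCategoryᵒᵖ}
    (hΦ : Function.Bijective (Φ.app U)) :
    Function.Bijective (((P.pullbackProj Φ).app (SingleObj.star _)).app U) := by
  constructor
  · rintro ⟨⟨x, p⟩, hx⟩ ⟨⟨x', _⟩, hx'⟩ rfl
    obtain rfl : x = x' := hΦ.injective (hx.trans hx'.symm)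
    rfl
  · intro p
    obtain ⟨x, hx⟩ := hΦ.surjective (P.proj.app U p)
    exact ⟨⟨(x, p), hx⟩, rfl⟩

instance isIso_pullbackProj (Φ : X ⟶ Y) [IsIso Φ] (P : PrincipalBundle G Y) :
    IsIso (P.pullbackProj Φ) := by
  have isIso_app_app (s : SingleObj Gᵐᵒᵖ) (U : SimplexCategoryᵒᵖ) :
      IsIso (((P.pullbackProj Φ).app s).app U) :=
    (isIso_iff_bijective _).2 <|
      P.bijective_pullbackProj_app ((isIso_iff_bijective (Φ.app U)).1 inferInstance)
  have isIso_app (s : SingleObj Gᵐᵒᵖ) : IsIso ((P.pullbackProj Φ).app s) :=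
    NatIso.isIso_of_isIso_app _
  exact NatIso.isIso_of_isIso_app _

lemma SameMappingClassOrbit.nonempty_total_iso {P P' : PrincipalBundle G X}
    (h : P.SameMappingClassOrbit P') : Nonempty (P.total ≅ P'.total) := by
  obtain ⟨Φ, ⟨e⟩⟩ := h
  exact ⟨(asIso (P.pullbackProj Φ.hom)).symm ≪≫ e.iso⟩

end PrincipalBundle

theorem proposition2p9_general {G : Type u} [Group G] {C : Type*} [Category* C]
    (F : RightGSpace G ⥤ C) :
    (∀ {X Y : SSet.{u}} (Φ : X ≅ Y) (P : PrincipalBundle G Y),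
      IsIso (F.map (P.pullbackProj Φ.hom))) ∧
    (∀ {X : SSet.{u}} (P P' : PrincipalBundle G X), P.SameMappingClassOrbit P' →
      Nonempty (F.obj P.total ≅ F.obj P'.total)) :=
  ⟨fun _ _ => inferInstance, fun _ _ h => h.nonempty_total_iso.map F.mapIso⟩

theorem proposition2p9 {k : Type u} [Field k] {G : Type u} [Group G] :
    (∀ {X Y : SSet.{u}} (Φ : X ≅ Y) (P : PrincipalBundle G Y) (A : EquivariantAlg k G)
      (R : EquivariantAlg.CofibrantReplacement A), IsIso (P.hochschildMap Φ.hom R)) ∧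
    (∀ {X : SSet.{u}} (P P' : PrincipalBundle G X), P.SameMappingClassOrbit P' →
      ∀ (A : EquivariantAlg k G) (R : EquivariantAlg.CofibrantReplacement A),
        Nonempty (P.hochschild R ≅ P'.hochschild R)) :=
  ⟨fun Φ P _ R => (proposition2p9_general (RightGSpace.derivedTensor R)).1 Φ P,
    fun P P' h _ R => (proposition2p9_general (RightGSpace.derivedTensor R)).2 P P' h⟩
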